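/- Fix a standard effective indexing of the primitive recursive (PR) functions $f:\mathbb{N}\to\mathbb{N}$ by programs (tuples of arguments being coded by a primitive recursive pairing). A set $P$ of indices or of natural numbers is $\Sigma_2$ if it can be written as $\{a : \exists x\,\forall y\; R(a,x,y)\}$ with $R$ decidable, and $\Pi_2$ if its complement is $\Sigma_2$. For $\mathcal{C}\in\{\Sigma_2,\Pi_2\}$, $P$ is $\mathcal{C}$-complete if $P\in\mathcal{C}$ and every set $Q\subseteq\mathbb{N}$ in $\mathcal{C}$ is many-one reducible to $P$ by a total computable function. Then: 1. The problem FINITE-CODOMAIN$^{\mathrm{PR}}$ (given an index of a PR function $f$, is $\{f(x) : x\in\mathbb{N}\}$ finite?) is $\Sigma_2$-complete. 2. The problem INFINITE-CODOMAIN$^{\mathrm{PR}}$ (given an index of a PR function $f$, is $\{f(x) : x\in\mathbb{N}\}$ infinite?) is $\Pi_2$-complete. 3. There is a total computable map on indices that sends an index of any PR function $f$ to an index of the PR function $g$ with $g(n)=\#\{\,i\le n : f(i)=0\,\}$ for all $n$, and it is a many-one reduction of the problem "does $f$ have only finitely many zeros?" to FINITE-CODOMAIN$^{\mathrm{PR}}$: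 for every PR function $f$, $f$ has finitely many zeros if and only if $g$ has finite codomain. -/

import Mathlib

namespace PRDecision

open Nat.Partrec (Code)

/-! ### The arithmetical hierarchy -/

/-- `IsSigma n p`: the predicate `p` belongs to the class `Σₙ`. The class `Σ₀` consists of the
decidable predicates, and `p` is in `Σₙ₊₁` when `p a ↔ ∃ x, r (a, x)` for a predicate `r` in `Πₙ`,
that is, for `r` the negation of a predicate `q` in `Σₙ`. -/
def IsSigma : (n : ℕ) → {α : Type} → [Primcodable α] → (α → Prop) → Prop
  | 0, _, _, p => ComputablePred p
  | n + 1, α, _, p => ∃ q : α × ℕ → Prop, IsSigma n q ∧ ∀ a, p a ↔ ∃ x, ¬ q (a, x)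

/-- `IsPi n p`: the predicate `p` belongs to the class `Πₙ`, i.e. its negation is in `Σₙ`. -/
def IsPi (n : ℕ) {α : Type} [Primcodable α] (p : α → Prop) : Prop :=
  IsSigma n fun a => ¬ p a

/-- `Σ₂` predicates are those of the form `∃ x, ∀ y, R a x y` with `R` decidable. -/
theorem isSigma_two_iff {α : Type} [Primcodable α] (p : α → Prop) :
    IsSigma 2 p ↔ ∃ R : (α × ℕ) × ℕ → Prop, ComputablePred R ∧
      ∀ a, p a ↔ ∃ x, ∀ y, R ((a, x), y) := by
  constructor
  · rintro ⟨q, ⟨R, hR, hq⟩, hp⟩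
    refine ⟨R, hR, fun a => ?_⟩
    rw [hp a]
    simp [hq]
  · rintro ⟨R, hR, hp⟩
    refine ⟨fun b => ∃ y, ¬ R (b, y), ⟨R, hR, fun b => Iff.rfl⟩, fun a => ?_⟩
    rw [hp a]
    simp

/-- `Π₂` predicates are those of the form `∀ x, ∃ y, R a x y` with `R` decidable. -/
theorem isPi_two_iff {α : Type} [Primcodable α] (p : α → Prop) :
    IsPi 2 p ↔ ∃ R : (α × ℕ) × ℕ → Prop, ComputablePred R ∧
      ∀ a, p a ↔ ∀ x, ∃ y, R ((a, x), y) := by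
  rw [IsPi, isSigma_two_iff]
  constructor
  · rintro ⟨R, hR, hp⟩
    refine ⟨fun b => ¬ R b, hR.not, fun a => ?_⟩
    rw [← not_iff_not, hp a]
    simp
  · rintro ⟨R, hR, hp⟩
    refine ⟨fun b => ¬ R b, hR.not, fun a => ?_⟩
    rw [hp a]
    simp

/-- `p` is m-complete in `Σₙ`: it belongs to `Σₙ`, and every set of natural numbers in `Σₙ`
is many-one reducible to it. -/
def SigmaComplete (n : ℕ) {α : Type} [Primcodable α] (p : α → Prop) : Prop :=
  IsSigma n p ∧ ∀ q : ℕ → Prop, IsSigma n q → q ≤₀ p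

/-- `p` is m-complete in `Πₙ`: it belongs to `Πₙ`, and every set of natural numbers in `Πₙ`
is many-one reducible to it. -/
def PiComplete (n : ℕ) {α : Type} [Primcodable α] (p : α → Prop) : Prop :=
  IsPi n p ∧ ∀ q : ℕ → Prop, IsPi n q → q ≤₀ p

/-! ### Indices of primitive recursive functions -/

/-- A program for a partial recursive function is a program for a primitive recursive function
if it does not use the minimization operator anywhere, i.e. it is built from zero, successor,
the two projections and pairing by composition and primitive recursion only. -/
def IsPRCode : Code → Prop
  | .zero => True
  | .succ => True
  | .left => True
  | .right => True
  | .pair cf cg => IsPRCode cf ∧ IsPRCode cg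
  | .comp cf cg => IsPRCode cf ∧ IsPRCode cg
  | .prec cf cg => IsPRCode cf ∧ IsPRCode cg
  | .rfind' _ => False

theorem isPRCode_primrec : PrimrecPred IsPRCode := by
  have h2 : ∀ {α : Type} [Primcodable α], Primrec fun a : α × Code × Code × Bool × Bool =>
      (a.2.2.2.1 && a.2.2.2.2) := fun {α} _ =>
    Primrec.and.comp
      (Primrec.fst.comp (Primrec.snd.comp (Primrec.snd.comp Primrec.snd)))
      (Primrec.snd.comp (Primrec.snd.comp (Primrec.snd.comp Primrec.snd)))
  have key := Code.primrec_recOn (α := Code) (σ := Bool) (c := id) Primrec.id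
    (z := fun _ => true) (Primrec.const true)
    (s := fun _ => true) (Primrec.const true)
    (l := fun _ => true) (Primrec.const true)
    (r := fun _ => true) (Primrec.const true)
    (pr := fun _ _ _ x y => x && y) h2
    (co := fun _ _ _ x y => x && y) h2
    (pc := fun _ _ _ x y => x && y) h2
    (rf := fun _ _ _ => false) (Primrec.const false)
  refine PrimrecPred.of_eq (p := fun c : Code => _ = true)
    (Primrec.eq.comp key (Primrec.const true)) fun c => ?_
  induction c <;> simp_all [IsPRCode]

/-- Programs (indices) of primitive recursive functions `ℕ → ℕ`. -/
def PRCode : Type := {c : Code // IsPRCode c}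

noncomputable instance : DecidablePred IsPRCode := Classical.decPred _

noncomputable instance : Primcodable PRCode := Primcodable.subtype isPRCode_primrec

theorem eval_pair_coe {cf cg : Code} {f g : ℕ → ℕ} (hf : ∀ n, cf.eval n = Part.some (f n))
    (hg : ∀ n, cg.eval n = Part.some (g n)) (n : ℕ) :
    (Code.pair cf cg).eval n = Part.some (Nat.pair (f n) (g n)) := by
  simp [Code.eval, hf, hg, Seq.seq]

theorem eval_comp_coe {cf cg : Code} {f g : ℕ → ℕ} (hf : ∀ n, cf.eval n = Part.some (f n))
    (hg : ∀ n, cg.eval n = Part.some (g n)) (n : ℕ) :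
    (Code.comp cf cg).eval n = Part.some (f (g n)) := by
  change (cg.eval n).bind cf.eval = _
  rw [hg]
  exact (Part.bind_some _ _).trans (hf _)

theorem eval_prec_coe {cf cg : Code} {f g : ℕ → ℕ} (hf : ∀ n, cf.eval n = Part.some (f n))
    (hg : ∀ n, cg.eval n = Part.some (g n)) (n : ℕ) :
    (Code.prec cf cg).eval n = Part.some (Nat.unpaired (fun z k =>
      k.rec (f z) fun y IH => g (Nat.pair z (Nat.pair y IH))) n) := by
  simp only [Code.eval, Nat.unpaired]
  generalize n.unpair.2 = k
  induction k with
  | zero => simp [hf]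
  | succ k ih =>
    exact (congrArg (fun p => Part.bind p fun i => cg.eval (Nat.pair n.unpair.1 (Nat.pair k i)))
      ih).trans ((Part.bind_some _ _).trans (hg _))

/-- A program without minimization computes a (total) primitive recursive function. -/
theorem IsPRCode.exists_primrec {c : Code} (hc : IsPRCode c) :
    ∃ f : ℕ → ℕ, Nat.Primrec f ∧ ∀ n, c.eval n = Part.some (f n) := by
  induction c with
  | zero => exact ⟨_, .zero, fun _ => rfl⟩
  | succ => exact ⟨_, .succ, fun _ => rfl⟩
  | left => exact ⟨_, .left, fun _ => rfl⟩
  | right => exact ⟨_, .right, fun _ => rfl⟩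
  | pair cf cg ihf ihg =>
    obtain ⟨f, pf, hf⟩ := ihf hc.1
    obtain ⟨g, pg, hg⟩ := ihg hc.2
    exact ⟨_, pf.pair pg, eval_pair_coe hf hg⟩
  | comp cf cg ihf ihg =>
    obtain ⟨f, pf, hf⟩ := ihf hc.1
    obtain ⟨g, pg, hg⟩ := ihg hc.2
    exact ⟨_, pf.comp pg, eval_comp_coe hf hg⟩
  | prec cf cg ihf ihg =>
    obtain ⟨f, pf, hf⟩ := ihf hc.1
    obtain ⟨g, pg, hg⟩ := ihg hc.2
    exact ⟨_, pf.prec pg, eval_prec_coe hf hg⟩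
  | rfind' cf _ => exact hc.elim

theorem IsPRCode.eval_dom {c : Code} (hc : IsPRCode c) (n : ℕ) : (c.eval n).Dom := by
  obtain ⟨f, _, h⟩ := hc.exists_primrec
  rw [h]
  trivial

/-- The primitive recursive function computed by a program. -/
def PRCode.eval (c : PRCode) (n : ℕ) : ℕ := (c.1.eval n).get (c.2.eval_dom n)

/-- The programs compute exactly the primitive recursive functions. -/
theorem primrec_iff_exists_code (f : ℕ → ℕ) : Nat.Primrec f ↔ ∃ c : PRCode, c.eval = f := by
  constructor
  · intro hf
    suffices h : ∃ c : Code, IsPRCode c ∧ ∀ n, c.eval n = Part.some (f n) by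
      obtain ⟨c, hc, h⟩ := h
      refine ⟨⟨c, hc⟩, funext fun n => ?_⟩
      simp [PRCode.eval, h]
    induction hf with
    | zero => exact ⟨.zero, trivial, fun _ => rfl⟩
    | succ => exact ⟨.succ, trivial, fun _ => rfl⟩
    | left => exact ⟨.left, trivial, fun _ => rfl⟩
    | right => exact ⟨.right, trivial, fun _ => rfl⟩
    | pair _ _ ihf ihg =>
      obtain ⟨cf, pf, hf⟩ := ihf
      obtain ⟨cg, pg, hg⟩ := ihg
      exact ⟨.pair cf cg, ⟨pf, pg⟩, eval_pair_coe hf hg⟩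
    | comp _ _ ihf ihg =>
      obtain ⟨cf, pf, hf⟩ := ihf
      obtain ⟨cg, pg, hg⟩ := ihg
      exact ⟨.comp cf cg, ⟨pf, pg⟩, eval_comp_coe hf hg⟩
    | prec _ _ ihf ihg =>
      obtain ⟨cf, pf, hf⟩ := ihf
      obtain ⟨cg, pg, hg⟩ := ihg
      exact ⟨.prec cf cg, ⟨pf, pg⟩, eval_prec_coe hf hg⟩
  · rintro ⟨c, rfl⟩
    obtain ⟨f, hf, h⟩ := c.2.exists_primrec
    refine hf.of_eq fun n => ?_
    simp [PRCode.eval, h]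

/-! ### Decision problems whose instance is a primitive recursive function -/

/-- FINITE-CODOMAIN: the set of values of the function is finite. -/
def FiniteCodomain (c : PRCode) : Prop := (Set.range c.eval).Finite

/-- INFINITE-CODOMAIN: the set of values of the function is infinite. -/
def InfiniteCodomain (c : PRCode) : Prop := (Set.range c.eval).Infinite

/-- FINITELY-MANY-ZEROS: the function has only finitely many zeros. -/
def FinitelyManyZeros (c : PRCode) : Prop := {x : ℕ | c.eval x = 0}.Finite

end PRDecision

namespace PRDecision

open Nat.Partrec (Code)

/-! ### Evaluation of programs for primitive recursive functions -/

/-! A set of naturals is finite iff it is bounded, and "some N bounds all values" is `Σ₂` because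
evaluating minimization-free programs is total and computable. For hardness, a `Σ₂` predicate is put
in the form `∃ x, ∀ w, ¬ T(a, x, w)` with `T` primitive recursive. For fixed `a`, `verifiedBound`
takes the value `m` once a stage `s` holds witnesses refuting every candidate `x < m`, so it is
bounded iff some candidate is never refuted (`exists_verifiedBound_le_iff`). Currying a single
program for it gives the reduction; complementation gives the `Π₂` case. The zero-counting function
is bounded iff there are finitely many zeros. -/

theorem PRCode.eval_val (c : PRCode) (n : ℕ) : c.1.eval n = Part.some (c.eval n) :=
  Part.eq_some_iff.2 (Part.get_mem _)

theorem PRCode.eval_eq_of_val {c : PRCode} {n v : ℕ} (h : c.1.eval n = Part.some v) :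
    c.eval n = v :=
  Part.some_injective ((c.eval_val n).symm.trans h)

theorem PRCode.primrec_val : Primrec (fun c : PRCode => c.1) :=
  Primrec.subtype_val (hp := isPRCode_primrec)

theorem PRCode.primrec_mk {α : Type} [Primcodable α] {f : α → Code} {h : ∀ a, IsPRCode (f a)}
    (hf : Primrec f) : @Primrec α PRCode _ _ fun a => ⟨f a, h a⟩ :=
  Primrec.subtype_mk (hp := isPRCode_primrec) hf

theorem PRCode.computable_eval : Computable fun p : PRCode × ℕ => p.1.eval p.2 := by
  have h : Partrec fun p : PRCode × ℕ => p.1.1.eval p.2 :=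
    Code.eval_part.comp (PRCode.primrec_val.to_comp.comp Computable.fst) Computable.snd
  exact h.of_eq fun p => p.1.eval_val p.2

/-! ### Currying -/

theorem isPRCode_const (n : ℕ) : IsPRCode (Code.const n) := by
  induction n with
  | zero => trivial
  | succ n ih => exact ⟨trivial, ih⟩

theorem IsPRCode.curry {c : Code} (hc : IsPRCode c) (n : ℕ) : IsPRCode (Code.curry c n) :=
  ⟨hc, isPRCode_const n, trivial, trivial⟩

/-- Substitution of a number for the first component of the argument. -/
def PRCode.curry (c : PRCode) (n : ℕ) : PRCode := ⟨Code.curry c.1 n, c.2.curry n⟩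

theorem PRCode.eval_curry (c : PRCode) (n x : ℕ) : (c.curry n).eval x = c.eval (Nat.pair n x) :=
  PRCode.eval_eq_of_val ((Code.eval_curry _ _ _).trans (c.eval_val _))

theorem PRCode.computable_curry (c : PRCode) : Computable c.curry :=
  (PRCode.primrec_mk (Code.primrec₂_curry.comp (Primrec.const c.1) Primrec.id)).to_comp

/-! ### Membership in `Σ₂` -/

theorem finiteCodomain_iff_exists_bound (c : PRCode) :
    FiniteCodomain c ↔ ∃ N, ∀ y, c.eval y ≤ N := by
  rw [FiniteCodomain, Set.finite_iff_bddAbove]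
  simp [BddAbove, Set.Nonempty, mem_upperBounds]

theorem isSigma_finiteCodomain : IsSigma 2 FiniteCodomain := by
  refine (isSigma_two_iff _).2 ⟨fun p => p.1.1.eval p.2 ≤ p.1.2, ?_,
    finiteCodomain_iff_exists_bound⟩
  have h : Computable fun p : (PRCode × ℕ) × ℕ => decide (p.1.1.eval p.2 ≤ p.1.2) :=
    Primrec.nat_le.decide.to_comp.comp
      (PRCode.computable_eval.comp
        ((Computable.fst.comp Computable.fst).pair Computable.snd))
      (Computable.snd.comp Computable.fst)
  exact h.computablePred

/-! ### Hardness -/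

/-- Kleene's normal form: recursively enumerable predicates are projections of primitive
recursive ones. -/
theorem exists_primrecPred_of_rePred {α : Type} [Primcodable α] {p : α → Prop} (hp : REPred p) :
    ∃ T : α × ℕ → Prop, PrimrecPred T ∧ ∀ a, p a ↔ ∃ k, T (a, k) := by
  obtain ⟨c, hc⟩ := Code.exists_code.1 hp
  refine ⟨fun b => (Code.evaln b.2 c (Encodable.encode b.1)).isSome = true, ?_, fun a => ?_⟩
  · exact Primrec.eq.comp (Primrec.option_isSome.comp (Code.primrec_evaln.comp
      ((Primrec.snd.pair (Primrec.const c)).pair (Primrec.encode.comp Primrec.fst))))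
      (Primrec.const true)
  · have hdom : p a ↔ (c.eval (Encodable.encode a)).Dom := by
      rw [hc]
      simp [Part.assert]
    simp only [hdom, Part.dom_iff_mem, Code.evaln_complete, Option.isSome_iff_exists,
      Option.mem_def]
    exact exists_comm

/-- The matrix of a `Σ₂` predicate can be chosen primitive recursive. -/
theorem IsSigma.exists_primrecPred {α : Type} [Primcodable α] {q : α → Prop} (hq : IsSigma 2 q) :
    ∃ T : (α × ℕ) × ℕ → Prop, PrimrecPred T ∧ ∀ a, q a ↔ ∃ x, ∀ w, ¬ T ((a, x), w) := by
  obtain ⟨R, hR, hq⟩ := (isSigma_two_iff q).1 hq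
  -- The normal form is applied to `¬ R`, so its search variable `k` becomes universal and merges
  -- with `y` into `w = ⟨y, k⟩`.
  obtain ⟨T, hT, hRT⟩ := exists_primrecPred_of_rePred hR.not.to_re
  refine ⟨fun b => T ((b.1, b.2.unpair.1), b.2.unpair.2), hT.comp ?_, fun a => ?_⟩
  · have hu : Primrec fun b : (α × ℕ) × ℕ => b.2.unpair := Primrec.unpair.comp Primrec.snd
    exact (Primrec.fst.pair (Primrec.fst.comp hu)).pair (Primrec.snd.comp hu)
  · rw [hq]
    refine exists_congr fun x => ?_
    rw [← not_iff_not]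
    push Not
    simp only [hRT]
    constructor
    · rintro ⟨y, k, h⟩
      exact ⟨Nat.pair y k, by simpa using h⟩
    · rintro ⟨w, h⟩
      exact ⟨_, _, h⟩

open Classical in
/-- At `⟨m, s⟩` the value is `m` if every `x < m` has a witness below `s`, and `0` otherwise. -/
noncomputable def verifiedBound (T : ℕ × ℕ → Prop) (n : ℕ) : ℕ :=
  if ∀ x < n.unpair.1, ∃ w < n.unpair.2, T (x, w) then n.unpair.1 else 0

theorem exists_verifiedBound_le_iff (T : ℕ × ℕ → Prop) :
    (∃ N, ∀ n, verifiedBound T n ≤ N) ↔ ∃ x, ∀ w, ¬ T (x, w) := by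
  constructor
  · rintro ⟨N, hN⟩
    by_contra! h
    choose w hw using h
    have hlt : ∀ x < N + 1, ∃ v < (Finset.range (N + 1)).sup w + 1, T (x, v) := fun x hx =>
      ⟨w x, Nat.lt_succ_of_le (Finset.le_sup (Finset.mem_range.2 hx)), hw x⟩
    -- At a stage past the chosen witnesses for all `x ≤ N`, the value is `N + 1`.
    have := hN (Nat.pair (N + 1) ((Finset.range (N + 1)).sup w + 1))
    rw [verifiedBound, Nat.unpair_pair, if_pos hlt] at this
    exact absurd this (by simp)
  · rintro ⟨x, hx⟩
    refine ⟨x, fun n => ?_⟩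
    rw [verifiedBound]
    split_ifs with h
    · by_contra! hlt
      obtain ⟨w, -, hw⟩ := h x hlt
      exact hx w hw
    · exact Nat.zero_le x

theorem primrecRel_exists_lt {β : Type} [Primcodable β] {R : ℕ → β → Prop} (hR : PrimrecRel R) :
    PrimrecRel fun n y => ∃ x < n, R x y :=
  (hR.exists_mem_list.comp (Primrec.list_range.comp Primrec.fst) Primrec.snd).of_eq (by simp)

theorem primrecRel_forall_lt {β : Type} [Primcodable β] {R : ℕ → β → Prop} (hR : PrimrecRel R) :
    PrimrecRel fun n y => ∀ x < n, R x y :=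
  (hR.forall_mem_list.comp (Primrec.list_range.comp Primrec.fst) Primrec.snd).of_eq (by simp)

/-- Both quantifiers are bounded by components of the argument. Uniformity in the parameter is what
allows one program to be curried. -/
theorem primrec_verifiedBound {α : Type} [Primcodable α] {T : (α × ℕ) × ℕ → Prop}
    (hT : PrimrecPred T) :
    Primrec fun p : α × ℕ => verifiedBound (fun b => T ((p.1, b.1), b.2)) p.2 := by
  have hm : Primrec fun p : α × ℕ => p.2.unpair.1 :=
    Primrec.fst.comp (Primrec.unpair.comp Primrec.snd)
  have hs : Primrec fun p : α × ℕ => p.2.unpair.2 :=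
    Primrec.snd.comp (Primrec.unpair.comp Primrec.snd)
  have hrel : PrimrecRel fun (w : ℕ) (b : α × ℕ) => T (b, w) :=
    hT.comp (Primrec.snd.pair Primrec.fst)
  have hx : Primrec fun a : ℕ × (α × ℕ) => (a.2.1, a.1) :=
    (Primrec.fst.comp Primrec.snd).pair Primrec.fst
  have hinner : PrimrecRel fun (x : ℕ) (p : α × ℕ) => ∃ w < p.2.unpair.2, T ((p.1, x), w) :=
    (primrecRel_exists_lt hrel).comp (hs.comp Primrec.snd) hx
  classical
  exact Primrec.ite ((primrecRel_forall_lt hinner).comp hm Primrec.id) hm (Primrec.const 0)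

theorem manyOneReducible_finiteCodomain {q : ℕ → Prop} (hq : IsSigma 2 q) :
    q ≤₀ FiniteCodomain := by
  obtain ⟨T, hT, hqT⟩ := hq.exists_primrecPred
  obtain ⟨c, hc⟩ := (primrec_iff_exists_code _).1
    (Primrec.nat_iff.1 ((primrec_verifiedBound hT).comp Primrec.unpair))
  refine ⟨c.curry, c.computable_curry, fun a => ?_⟩
  rw [finiteCodomain_iff_exists_bound, hqT,
    ← exists_verifiedBound_le_iff fun b => T ((a, b.1), b.2)]
  simp [PRCode.eval_curry, hc]

theorem sigmaComplete_finiteCodomain : SigmaComplete 2 FiniteCodomain :=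
  ⟨isSigma_finiteCodomain, fun _ => manyOneReducible_finiteCodomain⟩

theorem piComplete_infiniteCodomain : PiComplete 2 InfiniteCodomain := by
  constructor
  · have h : (fun c => ¬ InfiniteCodomain c) = FiniteCodomain :=
      funext fun _ => propext Set.not_infinite
    rw [IsPi, h]
    exact isSigma_finiteCodomain
  · intro q hq
    -- `hq` says that `¬ q` is `Σ₂`; a reduction of complements also reduces the original sets.
    obtain ⟨f, hf, h⟩ := manyOneReducible_finiteCodomain hq
    exact ⟨f, hf, fun a => not_iff_not.1 ((h a).trans Set.not_infinite.symm)⟩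

/-! ### Counting zeros -/

/-- The argument pairs a value of `f` with the running count. This program does not depend on `f`.
-/
theorem exists_countStep : ∃ s : PRCode, ∀ n,
    s.eval n = if n.unpair.1 = 0 then n.unpair.2 + 1 else n.unpair.2 := by
  have h : Primrec fun n : ℕ => if n.unpair.1 = 0 then n.unpair.2 + 1 else n.unpair.2 :=
    have hu : Primrec fun n : ℕ => n.unpair.2 := Primrec.snd.comp Primrec.unpair
    Primrec.ite (Primrec.eq.comp (Primrec.fst.comp Primrec.unpair) (Primrec.const 0))
      (Primrec.succ.comp hu) hu
  obtain ⟨s, hs⟩ := (primrec_iff_exists_code _).1 (Primrec.nat_iff.1 h)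
  exact ⟨s, congrFun hs⟩

/-- From a program for `f`, a program counting the zeros of `f` up to its argument. -/
theorem exists_computable_countZeros : ∃ r : PRCode → PRCode, Computable r ∧
    ∀ (c : PRCode) (n : ℕ),
      (r c).eval n = ((Finset.range (n + 1)).filter fun i => c.eval i = 0).card := by
  obtain ⟨s, hs⟩ := exists_countStep
  -- `prec` supplies `⟨z, ⟨i, count⟩⟩`; the projections select `i` and `count`.
  let step (c : Code) : Code :=
    .comp s.1 (.pair (.comp c (.comp .left .right)) (.comp .right .right))
  -- The input is `⟨0, n + 1⟩`: a dummy parameter, and `n + 1` rounds so that `i = n` is counted.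
  refine ⟨fun c => ⟨.comp (.prec .zero (step c.1)) (.pair .zero .succ),
    ⟨⟨trivial, s.2, ⟨c.2, trivial, trivial⟩, trivial, trivial⟩, trivial, trivial⟩⟩,
    (PRCode.primrec_mk (α := PRCode) ?_).to_comp, fun c n => ?_⟩
  · have hstep : Primrec fun c : PRCode => step c.1 :=
      Code.primrec₂_comp.comp (Primrec.const _) (Code.primrec₂_pair.comp
        (Code.primrec₂_comp.comp PRCode.primrec_val (Primrec.const _)) (Primrec.const _))
    exact Code.primrec₂_comp.comp
      (Code.primrec₂_prec.comp (Primrec.const _) hstep) (Primrec.const _)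
  · have hleft : ∀ n, Code.left.eval n = Part.some n.unpair.1 := fun _ => rfl
    have hright : ∀ n, Code.right.eval n = Part.some n.unpair.2 := fun _ => rfl
    have hzero : ∀ n, Code.zero.eval n = Part.some 0 := fun _ => rfl
    have hsucc : ∀ n, Code.succ.eval n = Part.some (n + 1) := fun _ => rfl
    have hstep := eval_comp_coe s.eval_val (eval_pair_coe
      (eval_comp_coe c.eval_val (eval_comp_coe hleft hright)) (eval_comp_coe hright hright))
    refine PRCode.eval_eq_of_val
      ((eval_comp_coe (eval_prec_coe hzero hstep) (eval_pair_coe hzero hsucc) n).trans ?_)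
    refine congrArg Part.some ?_
    rw [Nat.unpaired, Nat.unpair_pair]
    generalize n + 1 = k
    induction k with
    | zero => rfl
    | succ k ih =>
      simp only [hs, Nat.unpair_pair] at ih ⊢
      simp only [ih, Finset.range_add_one, Finset.filter_insert]
      split_ifs <;> simp

theorem finite_iff_exists_card_filter_le (p : ℕ → Prop) [DecidablePred p] :
    {x | p x}.Finite ↔ ∃ N, ∀ n, ((Finset.range (n + 1)).filter p).card ≤ N := by
  constructor
  · intro h
    refine ⟨h.toFinset.card, fun n => Finset.card_le_card fun x hx => ?_⟩
    simpa using (Finset.mem_filter.1 hx).2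
  · rintro ⟨N, hN⟩
    by_contra h
    obtain ⟨t, ht, hcard⟩ := Set.Infinite.exists_subset_card_eq h (N + 1)
    -- Any `N + 1` solutions lie in one initial segment, whose count then exceeds `N`.
    have hsub : t ⊆ (Finset.range (t.sup id + 1)).filter p := fun x hx =>
      Finset.mem_filter.2 ⟨Finset.mem_range.2 (Nat.lt_succ_of_le (Finset.le_sup (f := id) hx)),
        ht hx⟩
    have := (Finset.card_le_card hsub).trans (hN _)
    omega

end PRDecision

theorem mainTheorem8 :
    PRDecision.SigmaComplete 2 PRDecision.FiniteCodomain ∧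
    PRDecision.PiComplete 2 PRDecision.InfiniteCodomain ∧
    ∃ r : PRDecision.PRCode → PRDecision.PRCode,
      Computable r ∧
      (∀ (c : PRDecision.PRCode) (n : ℕ),
        (r c).eval n = ((Finset.range (n + 1)).filter fun i => c.eval i = 0).card) ∧
      ∀ c : PRDecision.PRCode,
        PRDecision.FinitelyManyZeros c ↔ PRDecision.FiniteCodomain (r c) := by
  obtain ⟨r, hr, h⟩ := PRDecision.exists_computable_countZeros
  refine ⟨PRDecision.sigmaComplete_finiteCodomain, PRDecision.piComplete_infiniteCodomain,
    r, hr, h, fun c => ?_⟩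
  simp only [PRDecision.finiteCodomain_iff_exists_bound, h]
  exact PRDecision.finite_iff_exists_card_filter_le _
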